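/- Let $\mu$ be a probability measure on $\mathbb{C}$ with compact support that has a continuous density $\rho$ with respect to Lebesgue measure, and suppose that $\rho$ is radial around the origin, i.e. $\rho(x)$ depends only on $|x|$. Let $z_1, z_2, z_3, \dots$ be independent random variables, each with distribution $\mu$, let $$ p_n(z) = \prod_{k=1}^{n} (z - z_k), $$ and let $w_1, \dots, w_n$ (depending on $n$) be the $n$ solutions, counted with multiplicity, of the equation $p_n(w) = p_n(0)$. Then, almost surely, $$ \frac{1}{n} \sum_{k=1}^{n} \delta_{w_k} \longrightarrow \mu \qquad \text{as } n \to \infty $$ in the sense of weak convergence of measures (equivalently, since all these measures are probability measures, in the sense of distributions). -/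

import Mathlib

open MeasureTheory ProbabilityTheory Filter Topology
open scoped NNReal ENNReal

noncomputable section

/-- The monic polynomial `p_n(x) = ∏_{k < n} (x - z_k)`. -/
def rootProduct (z : ℕ → ℂ) (n : ℕ) : Polynomial ℂ :=
  ∏ k ∈ Finset.range n, (Polynomial.X - Polynomial.C (z k))

/-- The solutions `w` of `p_n(w) = p_n(0)`, listed with multiplicity. -/
def levelSolutions (z : ℕ → ℂ) (n : ℕ) : Multiset ℂ :=
  (rootProduct z n - Polynomial.C ((rootProduct z n).eval 0)).roots

/-- The normalized counting measure `n⁻¹ ∑_w δ_w` of the solutions of `p_n(w) = p_n(0)`. -/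
def levelMeasure (z : ℕ → ℂ) (n : ℕ) : FiniteMeasure ℂ :=
  (n : ℝ≥0)⁻¹ • ((levelSolutions z n).map fun w => (diracProba w).toFiniteMeasure).sum

end

/-!
Write `U μ x = ∫ log |x - w| dμ(w)` for the logarithmic potential (`logPotential`), and let `ν n` be
the normalized counting measure of the solutions of `p_n(w) = p_n(0)`. Its potential is
`n⁻¹ log |p_n(x) - p_n(0)|`. By the strong law of large numbers and Fubini's theorem, almost surely
`n⁻¹ log |p_n(x)| → U μ x` for `x = 0` and for almost every `x`. Wherever `U μ x > U μ 0`, the term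
`p_n(0)` is therefore exponentially smaller than `p_n(x)`, and `U (ν n) x → U μ x`.

Radiality enters through Newton's theorem `U μ x = ∫ log (max |x| |w|) dμ(w)`
(`logPotential_eq_integral_log_max`): it shows `U μ x > U μ 0` as soon as `μ` charges the disc
`|w| < |x|` (`logPotential_zero_lt`). The set of such `x` contains `A = {x | m < |x|}`, where `m` is
the least modulus of a point of the support, and `A` is an open set of full measure. Nothing is
claimed about the potentials in the hole `|x| ≤ m`; as `μ A = 1`, no limit mass can sit there.

What remains is `tendsto_of_tendsto_logPotential`: convergence of potentials almost everywhere on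
an open set of full limit measure gives weak convergence. The roots stay in a fixed disc, so the
potentials are uniformly integrable on bounded sets and converge in `L¹` on compact subsets of `A`.
In place of the distributional identity `Δ U μ = 2π μ`, the proof uses the difference of the circle
averages of `log |· - w|` over the radii `2ε` and `ε` about `c`, which is an explicit nonnegative
bump function of `w` near `c` (`logBump`). Integrated over centres `c` in a compact set, these bumps
are test functions which are constant on a given compact set and vanish off a neighbourhood, and
whose integrals against a measure are integrals of its potential against a bounded weight.
The portmanteau theorem concludes.
-/

/-! ### Logarithmic potentials and uniform integrability -/

/-- The logarithmic potential `∫ log |z - w| dν(w)` of `ν`. The integrand is `0` instead of `-∞` at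
`w = z`, which for a discrete `ν` changes the potential only at its atoms, a null set. -/
noncomputable def logPotential (ν : Measure ℂ) (z : ℂ) : ℝ :=
  ∫ w, Real.log ‖z - w‖ ∂ν

lemma integrableOn_log_norm (r : ℝ) :
    IntegrableOn (fun z : ℂ => Real.log ‖z‖) (Metric.ball 0 r) := by
  rw [integrableOn_fun_norm_addHaar (μ := (volume : Measure ℂ)) (f := Real.log)]
  simp only [Complex.finrank_real_complex, smul_eq_mul, Nat.add_one_sub_one, pow_one]
  exact (Real.continuous_mul_log.continuousOn.integrableOn_Icc (a := 0) (b := r)).mono_set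
    Set.Ioo_subset_Icc_self

lemma setLIntegral_enorm_log_norm_sub {E : Set ℂ} (hE : MeasurableSet E) (w : ℂ) :
    ∫⁻ z in E, ‖Real.log ‖z - w‖‖ₑ = ∫⁻ z in (· + w) ⁻¹' E, ‖Real.log ‖z‖‖ₑ := by
  rw [← (measurePreserving_add_right (volume : Measure ℂ) w).setLIntegral_comp_preimage hE
    (by fun_prop)]
  simp

lemma preimage_add_subset_ball {E : Set ℂ} {R S : ℝ} {w : ℂ} (hE : E ⊆ Metric.closedBall 0 S)
    (hw : ‖w‖ ≤ R) : (· + w) ⁻¹' E ⊆ Metric.ball 0 (S + R + 1) := by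
  intro z hz
  have h1 : ‖z + w‖ ≤ S := by simpa using hE hz
  have h2 : ‖z‖ ≤ ‖z + w‖ + ‖w‖ := by simpa using norm_sub_le (z + w) w
  simp only [Metric.mem_ball, dist_zero_right]
  linarith

lemma exists_setLIntegral_enorm_log_norm_sub_le (R S : ℝ) :
    ∃ C : ℝ≥0, ∀ w : ℂ, ‖w‖ ≤ R →
      ∫⁻ z in Metric.closedBall 0 S, ‖Real.log ‖z - w‖‖ₑ ≤ C := by
  have h := (integrableOn_log_norm (S + R + 1)).2
  refine ⟨(∫⁻ z in Metric.ball (0 : ℂ) (S + R + 1), ‖Real.log ‖z‖‖ₑ).toNNReal, fun w hw => ?_⟩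
  rw [ENNReal.coe_toNNReal h.ne, setLIntegral_enorm_log_norm_sub measurableSet_closedBall]
  exact lintegral_mono_set (preimage_add_subset_ball subset_rfl hw)

/-- The functions `log ‖· - w‖`, for `w` in a bounded set, are uniformly integrable on bounded
sets: they are all translates of the single locally integrable function `log ‖·‖`. -/
lemma exists_forall_setLIntegral_enorm_log_norm_sub_le (R S : ℝ) {ε : ℝ} (hε : 0 < ε) :
    ∃ δ : ℝ, 0 < δ ∧ ∀ E : Set ℂ, MeasurableSet E → E ⊆ Metric.closedBall 0 S →
      volume E ≤ ENNReal.ofReal δ → ∀ w : ℂ, ‖w‖ ≤ R →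
        ∫⁻ z in E, ‖Real.log ‖z - w‖‖ₑ ≤ ENNReal.ofReal ε := by
  have h := (integrable_indicator_iff measurableSet_ball).2 (integrableOn_log_norm (S + R + 1))
  obtain ⟨δ, hδ, H⟩ := (memLp_one_iff_integrable.2 h).eLpNorm_indicator_le le_rfl
    ENNReal.one_ne_top hε
  refine ⟨δ, hδ, fun E hE hES hvol w hw => ?_⟩
  have hm : MeasurableSet ((· + w) ⁻¹' E) := hE.preimage (measurable_add_const w)
  have := H _ hm (by rwa [measure_preimage_add_right])
  rw [Set.indicator_indicator, Set.inter_eq_left.2 (preimage_add_subset_ball hES hw),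
    eLpNorm_one_eq_lintegral_enorm] at this
  rw [setLIntegral_enorm_log_norm_sub hE]
  simpa only [enorm_indicator_eq_indicator_enorm, lintegral_indicator hm] using this

/-- Joint integrability of the logarithmic kernel against a measure of bounded density and bounded
support in one variable and a finite measure carried by a bounded set in the other. The second
measure may be parametrized by `g`; this covers circles as well as measures on `ℂ`. -/
lemma integrable_log_norm_sub_prod {T : Type*} [MeasurableSpace T] {l : Measure ℂ}
    [IsFiniteMeasure l] {M : ℝ≥0} {S R : ℝ}
    (hl : l ≤ M • volume.restrict (Metric.closedBall 0 S)) (τ : Measure T) [IsFiniteMeasure τ]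
    {g : T → ℂ} (hg : Measurable g) (hgR : ∀ᵐ t ∂τ, ‖g t‖ ≤ R) :
    Integrable (fun p : ℂ × T => Real.log ‖p.1 - g p.2‖) (l.prod τ) := by
  have hmeas : Measurable (fun p : ℂ × T => Real.log ‖p.1 - g p.2‖) := by fun_prop
  refine ⟨hmeas.aestronglyMeasurable, ?_⟩
  obtain ⟨C, hC⟩ := exists_setLIntegral_enorm_log_norm_sub_le R S
  rw [HasFiniteIntegral, lintegral_prod_symm' _ hmeas.enorm]
  refine lt_of_le_of_lt (lintegral_mono_ae (g := fun _ => (M * C : ℝ≥0∞)) ?_) ?_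
  · filter_upwards [hgR] with t ht
    refine (lintegral_mono' hl le_rfl).trans ?_
    rw [lintegral_smul_measure]
    exact mul_le_mul_right (hC _ ht) _
  · rw [lintegral_const]
    exact ENNReal.mul_lt_top (ENNReal.mul_lt_top ENNReal.coe_lt_top ENNReal.coe_lt_top)
      (measure_lt_top _ _)

lemma measurable_logPotential (ν : Measure ℂ) [SFinite ν] : Measurable (logPotential ν) := by
  have : StronglyMeasurable (fun p : ℂ × ℂ => Real.log ‖p.1 - p.2‖) :=
    Measurable.stronglyMeasurable (by fun_prop)
  exact this.integral_prod_right.measurable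

lemma setLIntegral_enorm_logPotential_le {E : Set ℂ} {ν : Measure ℂ}
    [IsProbabilityMeasure ν] {R : ℝ} {C : ℝ≥0∞} (hν : ∀ᵐ w ∂ν, ‖w‖ ≤ R)
    (hC : ∀ w, ‖w‖ ≤ R → ∫⁻ z in E, ‖Real.log ‖z - w‖‖ₑ ≤ C) :
    ∫⁻ z in E, ‖logPotential ν z‖ₑ ≤ C := by
  calc ∫⁻ z in E, ‖logPotential ν z‖ₑ
      ≤ ∫⁻ z in E, ∫⁻ w, ‖Real.log ‖z - w‖‖ₑ ∂ν :=
        lintegral_mono fun z => enorm_integral_le_lintegral_enorm _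
    _ = ∫⁻ w, (∫⁻ z in E, ‖Real.log ‖z - w‖‖ₑ) ∂ν :=
        lintegral_lintegral_swap (Measurable.aemeasurable (by fun_prop))
    _ ≤ ∫⁻ _, C ∂ν := lintegral_mono_ae (by filter_upwards [hν] with w hw using hC w hw)
    _ = C := by simp

lemma integrableOn_logPotential {S R : ℝ} {ν : Measure ℂ} [IsProbabilityMeasure ν]
    (hν : ∀ᵐ w ∂ν, ‖w‖ ≤ R) : IntegrableOn (logPotential ν) (Metric.closedBall 0 S) := by
  obtain ⟨C, hC⟩ := exists_setLIntegral_enorm_log_norm_sub_le R S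
  exact ⟨(measurable_logPotential ν).aestronglyMeasurable,
    (setLIntegral_enorm_logPotential_le hν hC).trans_lt ENNReal.coe_lt_top⟩

/-- Logarithmic potentials of probability measures carried by a common bounded set which converge
almost everywhere on a bounded set converge there in `L¹`, by Vitali's theorem. -/
lemma tendsto_eLpNorm_logPotential_sub {E : Set ℂ} {S R : ℝ} (hE : MeasurableSet E)
    (hES : E ⊆ Metric.closedBall 0 S) {ν : ℕ → Measure ℂ} {ν' : Measure ℂ}
    [∀ n, IsProbabilityMeasure (ν n)] [IsProbabilityMeasure ν']
    (hν : ∀ n, ∀ᵐ w ∂ν n, ‖w‖ ≤ R) (hν' : ∀ᵐ w ∂ν', ‖w‖ ≤ R)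
    (hlim : ∀ᵐ z ∂volume.restrict E,
      Tendsto (fun n => logPotential (ν n) z) atTop (𝓝 (logPotential ν' z))) :
    Tendsto (fun n => eLpNorm (logPotential (ν n) - logPotential ν') 1 (volume.restrict E))
      atTop (𝓝 0) := by
  have : IsFiniteMeasure (volume.restrict E) :=
    ⟨by
      rw [Measure.restrict_apply_univ]
      exact (measure_mono hES).trans_lt measure_closedBall_lt_top⟩
  refine tendsto_Lp_finite_of_tendsto_ae le_rfl ENNReal.one_ne_top
    (fun n => (measurable_logPotential _).aestronglyMeasurable)
    (memLp_one_iff_integrable.2 ((integrableOn_logPotential hν').mono_set hES)) ?_ hlim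
  intro ε hε
  obtain ⟨δ, hδ, H⟩ := exists_forall_setLIntegral_enorm_log_norm_sub_le R S hε
  refine ⟨δ, hδ, fun n s hs hvol => ?_⟩
  rw [Measure.restrict_apply hs] at hvol
  rw [eLpNorm_one_eq_lintegral_enorm]
  simp only [enorm_indicator_eq_indicator_enorm]
  rw [lintegral_indicator hs, Measure.restrict_restrict hs]
  exact setLIntegral_enorm_logPotential_le (hν n)
    (H _ (hs.inter hE) (Set.inter_subset_right.trans hES) hvol)

/-! ### Circle averages of potentials, integrated over their centres -/

/-- The fraction of the circle of radius `r` centred at `z` that lies in `K`. -/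
noncomputable def circleFraction (K : Set ℂ) (r : ℝ) (z : ℂ) : ℝ :=
  (2 * Real.pi)⁻¹ * ∫ θ in Set.Ioc 0 (2 * Real.pi), K.indicator 1 (z - circleMap 0 r θ)

/-- The integral over centres `c ∈ K` of the mean of `log ‖· - w‖` on the circle of radius `r`
about `c`. -/
noncomputable def circleAverageIntegral (K : Set ℂ) (r : ℝ) (w : ℂ) : ℝ :=
  ∫ c in K, Real.circleAverage (fun z => Real.log ‖z - w‖) c r

lemma measurable_indicator_sub_circleMap {K : Set ℂ} (hK : MeasurableSet K) (r : ℝ) :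
    Measurable (fun p : ℂ × ℝ => K.indicator (1 : ℂ → ℝ) (p.1 - circleMap 0 r p.2)) := by
  have : Measurable (K.indicator (1 : ℂ → ℝ)) := measurable_one.indicator hK
  exact this.comp (measurable_fst.sub ((continuous_circleMap 0 r).measurable.comp measurable_snd))

lemma norm_indicator_one_le (K : Set ℂ) (z : ℂ) : ‖K.indicator (1 : ℂ → ℝ) z‖ ≤ 1 :=
  (norm_indicator_le_norm_self _ _).trans (by simp)

lemma measurable_circleFraction {K : Set ℂ} (hK : MeasurableSet K) (r : ℝ) :
    Measurable (circleFraction K r) :=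
  ((measurable_indicator_sub_circleMap hK r).stronglyMeasurable.integral_prod_right).measurable
    |>.const_mul _

lemma norm_circleFraction_le (K : Set ℂ) (r : ℝ) (z : ℂ) : ‖circleFraction K r z‖ ≤ 1 := by
  have h := norm_setIntegral_le_of_norm_le_const (μ := volume)
    (s := Set.Ioc 0 (2 * Real.pi)) (f := fun θ => K.indicator (1 : ℂ → ℝ) (z - circleMap 0 r θ))
    (C := 1) measure_Ioc_lt_top (fun θ _ => norm_indicator_one_le _ _)
  have h2 : (volume : Measure ℝ).real (Set.Ioc 0 (2 * Real.pi)) = 2 * Real.pi := by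
    simp [Real.pi_pos.le]
  have h3 : (0 : ℝ) < 2 * Real.pi := by positivity
  rw [circleFraction, norm_mul, norm_inv, Real.norm_of_nonneg h3.le, inv_mul_le_iff₀ h3]
  simpa only [one_mul, mul_one, h2] using h

/-- Exchanging the integration over centres with the circle average turns the weight `1_K` into
the weight `circleFraction K r`. -/
lemma circleAverageIntegral_eq {K : Set ℂ} (hK : IsCompact K) {r : ℝ} (hr : 0 ≤ r) (w : ℂ) :
    circleAverageIntegral K r w =
      ∫ z in Metric.cthickening r K, circleFraction K r z * Real.log ‖z - w‖ := by
  set σ : Measure ℝ := volume.restrict (Set.Ioc 0 (2 * Real.pi)) with hσ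
  obtain ⟨S, hS⟩ := hK.isBounded.subset_closedBall (0 : ℂ)
  obtain ⟨S', hS'⟩ := hK.isBounded.cthickening.subset_closedBall (0 : ℂ)
  have hKm := hK.measurableSet
  have : IsFiniteMeasure ((volume : Measure ℂ).restrict K) :=
    ⟨by simpa using hK.measure_lt_top⟩
  have : IsFiniteMeasure ((volume : Measure ℂ).restrict (Metric.cthickening r K)) :=
    ⟨by simpa using (measure_mono hS').trans_lt measure_closedBall_lt_top⟩
  have h1 : Integrable (fun p : ℂ × ℝ => Real.log ‖p.1 - (w - circleMap 0 r p.2)‖)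
      ((volume.restrict K).prod σ) := by
    refine integrable_log_norm_sub_prod (M := 1) (S := S) (R := ‖w‖ + r)
      (by simpa using Measure.restrict_mono hS le_rfl) σ
      (measurable_const.sub (continuous_circleMap 0 r).measurable) (ae_of_all _ fun θ => ?_)
    exact (norm_sub_le _ _).trans (by simp [abs_of_nonneg hr])
  have h2 : Integrable (fun p : ℂ × ℝ => K.indicator (1 : ℂ → ℝ) (p.1 - circleMap 0 r p.2) *
      Real.log ‖p.1 - w‖) ((volume.restrict (Metric.cthickening r K)).prod σ) := by
    refine (integrable_log_norm_sub_prod (M := 1) (S := S') (R := ‖w‖)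
      (by simpa using Measure.restrict_mono hS' le_rfl) σ
      measurable_const (ae_of_all _ fun θ => le_rfl)).bdd_mul (c := 1)
      (measurable_indicator_sub_circleMap hKm r).aestronglyMeasurable
      (ae_of_all _ fun p => norm_indicator_one_le _ _)
  have h3 (θ : ℝ) : ∫ c in K, Real.log ‖c - (w - circleMap 0 r θ)‖ =
      ∫ z in Metric.cthickening r K, K.indicator (1 : ℂ → ℝ) (z - circleMap 0 r θ) *
        Real.log ‖z - w‖ := by
    rw [← integral_indicator hKm, setIntegral_eq_integral_of_forall_compl_eq_zero,
      ← integral_sub_right_eq_self _ (circleMap 0 r θ)]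
    · refine integral_congr_ae (ae_of_all _ fun z => ?_)
      by_cases hz : z - circleMap 0 r θ ∈ K <;> simp [hz]
    · intro z hz
      rw [Set.indicator_of_notMem, zero_mul]
      refine fun h => hz (Metric.mem_cthickening_of_dist_le _ _ _ _ h ?_)
      simp [abs_of_nonneg hr]
  calc circleAverageIntegral K r w
      = ∫ c in K, (2 * Real.pi)⁻¹ * ∫ θ, Real.log ‖c - (w - circleMap 0 r θ)‖ ∂σ := by
        refine integral_congr_ae (ae_of_all _ fun c => ?_)
        simp only [Real.circleAverage, smul_eq_mul]
        rw [intervalIntegral.integral_of_le (by positivity)]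
        congr 2
        ext θ
        simp only [circleMap]
        ring_nf
    _ = (2 * Real.pi)⁻¹ * ∫ θ, (∫ c in K, Real.log ‖c - (w - circleMap 0 r θ)‖) ∂σ := by
        rw [integral_const_mul, integral_integral_swap h1]
    _ = (2 * Real.pi)⁻¹ * ∫ z in Metric.cthickening r K, ∫ θ,
          K.indicator (1 : ℂ → ℝ) (z - circleMap 0 r θ) * Real.log ‖z - w‖ ∂σ := by
        simp_rw [h3]
        rw [← integral_integral_swap h2]
    _ = _ := by
        rw [← integral_const_mul]
        refine integral_congr_ae (ae_of_all _ fun z => ?_)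
        simp only [circleFraction, integral_mul_const]
        ring

lemma integrable_circleFraction_mul_log {K : Set ℂ} (hK : IsCompact K) (r : ℝ)
    (ν : Measure ℂ) [IsFiniteMeasure ν] {R : ℝ} (hν : ∀ᵐ w ∂ν, ‖w‖ ≤ R) :
    Integrable (fun p : ℂ × ℂ => circleFraction K r p.1 * Real.log ‖p.1 - p.2‖)
      ((volume.restrict (Metric.cthickening r K)).prod ν) := by
  obtain ⟨S, hS⟩ := hK.isBounded.cthickening.subset_closedBall (0 : ℂ)
  have : IsFiniteMeasure ((volume : Measure ℂ).restrict (Metric.cthickening r K)) :=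
    ⟨by simpa using (measure_mono hS).trans_lt measure_closedBall_lt_top⟩
  exact (integrable_log_norm_sub_prod (M := 1) (S := S)
    (by simpa using Measure.restrict_mono hS le_rfl) ν measurable_id hν).bdd_mul (c := 1)
    ((measurable_circleFraction hK.measurableSet r).comp measurable_fst).aestronglyMeasurable
    (ae_of_all _ fun p => norm_circleFraction_le _ _ _)

lemma integrable_circleAverageIntegral {K : Set ℂ} (hK : IsCompact K) {r : ℝ} (hr : 0 ≤ r)
    (ν : Measure ℂ) [IsFiniteMeasure ν] {R : ℝ} (hν : ∀ᵐ w ∂ν, ‖w‖ ≤ R) :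
    Integrable (circleAverageIntegral K r) ν := by
  rw [funext (circleAverageIntegral_eq hK hr)]
  exact (integrable_circleFraction_mul_log hK r ν hν).integral_prod_right

lemma integral_circleAverageIntegral {K : Set ℂ} (hK : IsCompact K) {r : ℝ} (hr : 0 ≤ r)
    (ν : Measure ℂ) [IsFiniteMeasure ν] {R : ℝ} (hν : ∀ᵐ w ∂ν, ‖w‖ ≤ R) :
    ∫ w, circleAverageIntegral K r w ∂ν =
      ∫ z in Metric.cthickening r K, circleFraction K r z * logPotential ν z := by
  rw [funext (circleAverageIntegral_eq hK hr),
    ← integral_integral_swap (integrable_circleFraction_mul_log hK r ν hν)]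
  simp only [integral_const_mul, logPotential]

lemma tendsto_integral_circleAverageIntegral {K : Set ℂ} (hK : IsCompact K) {r R : ℝ}
    (hr : 0 ≤ r) {ν : ℕ → Measure ℂ} {ν' : Measure ℂ} [∀ n, IsProbabilityMeasure (ν n)]
    [IsProbabilityMeasure ν'] (hν : ∀ n, ∀ᵐ w ∂ν n, ‖w‖ ≤ R) (hν' : ∀ᵐ w ∂ν', ‖w‖ ≤ R)
    (hlim : ∀ᵐ z ∂volume.restrict (Metric.cthickening r K),
      Tendsto (fun n => logPotential (ν n) z) atTop (𝓝 (logPotential ν' z))) :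
    Tendsto (fun n => ∫ w, circleAverageIntegral K r w ∂ν n) atTop
      (𝓝 (∫ w, circleAverageIntegral K r w ∂ν')) := by
  obtain ⟨S, hS⟩ := hK.isBounded.cthickening.subset_closedBall (0 : ℂ)
  have h := tendsto_eLpNorm_logPotential_sub Metric.isClosed_cthickening.measurableSet hS
    hν hν' hlim
  simp only [integral_circleAverageIntegral hK hr _ hν',
    fun n => integral_circleAverageIntegral hK hr _ (hν n)]
  have hm := measurable_circleFraction hK.measurableSet r
  have hi {κ : Measure ℂ} [IsProbabilityMeasure κ] (hκ : ∀ᵐ w ∂κ, ‖w‖ ≤ R) :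
      IntegrableOn (fun z => circleFraction K r z * logPotential κ z) (Metric.cthickening r K) :=
    ((integrableOn_logPotential hκ).mono_set hS).bdd_mul (c := 1) hm.aestronglyMeasurable
      (ae_of_all _ fun p => norm_circleFraction_le _ _ _)
  refine tendsto_integral_of_L1 _ (hi hν').aestronglyMeasurable (.of_forall fun n => hi (hν n)) ?_
  refine tendsto_of_tendsto_of_tendsto_of_le_of_le tendsto_const_nhds h (fun _ => zero_le) ?_
  intro n
  simp only [eLpNorm_one_eq_lintegral_enorm]
  refine lintegral_mono fun z => ?_
  rw [← mul_sub, enorm_mul]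
  refine mul_le_of_le_one_left' ?_
  rw [← ofReal_norm]
  exact ENNReal.ofReal_le_one.2 (norm_circleFraction_le _ _ _)

/-! ### Convergence of potentials implies weak convergence -/

/-- The difference of the means of `log ‖· - x‖` over the circles of radius `2 * ε` and `ε` about
the origin: a bump function supported in the disc of radius `2 * ε`. -/
noncomputable def logBump (ε : ℝ) (x : ℂ) : ℝ :=
  Real.log (max (2 * ε) ‖x‖) - Real.log (max ε ‖x‖)

lemma circleAverage_log_norm_sub_eq_log_max (c a : ℂ) {r : ℝ} (hr : 0 < r) :
    Real.circleAverage (fun z => Real.log ‖z - a‖) c r = Real.log (max r ‖c - a‖) := by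
  rw [circleAverage_log_norm_sub_const_eq_log_radius_add_posLog hr.ne',
    Real.posLog_eq_log_max_one (by positivity), ← Real.log_mul hr.ne' (by positivity),
    mul_max_of_nonneg _ _ hr.le, mul_one, mul_inv_cancel_left₀ hr.ne']

lemma continuous_logBump {ε : ℝ} (hε : 0 < ε) : Continuous (logBump ε) := by
  unfold logBump
  refine .sub (.log (by fun_prop) fun x => ?_) (.log (by fun_prop) fun x => ?_) <;> positivity

lemma logBump_nonneg {ε : ℝ} (hε : 0 < ε) (x : ℂ) : 0 ≤ logBump ε x :=
  sub_nonneg.2 (Real.log_le_log (by positivity) (max_le_max_right _ (by linarith)))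

lemma logBump_eq_zero {ε : ℝ} (hε : 0 < ε) {x : ℂ} (hx : 2 * ε ≤ ‖x‖) : logBump ε x = 0 := by
  rw [logBump, max_eq_right hx, max_eq_right (by linarith), sub_self]

lemma hasCompactSupport_logBump {ε : ℝ} (hε : 0 < ε) : HasCompactSupport (logBump ε) := by
  refine .intro (isCompact_closedBall (0 : ℂ) (2 * ε)) fun x hx => logBump_eq_zero hε ?_
  simp only [Metric.mem_closedBall, dist_zero_right, not_le] at hx
  exact hx.le

lemma integrable_logBump {ε : ℝ} (hε : 0 < ε) : Integrable (logBump ε) :=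
  (continuous_logBump hε).integrable_of_hasCompactSupport (hasCompactSupport_logBump hε)

lemma integral_logBump_pos {ε : ℝ} (hε : 0 < ε) : 0 < ∫ x, logBump ε x := by
  refine (continuous_logBump hε).integral_pos_of_hasCompactSupport_nonneg_nonzero
    (hasCompactSupport_logBump hε) (logBump_nonneg hε) (x := 0) ?_
  rw [logBump, norm_zero, max_eq_left (by positivity), max_eq_left hε.le, sub_ne_zero]
  exact (Real.log_lt_log hε (by linarith)).ne'

lemma integrable_logBump_sub {ε : ℝ} (hε : 0 < ε) (w : ℂ) :
    Integrable (fun c => logBump ε (c - w)) :=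
  (integrable_logBump hε).comp_sub_right w

lemma circleAverageIntegral_sub_eq {K : Set ℂ} (hK : IsCompact K) {ε : ℝ} (hε : 0 < ε) (w : ℂ) :
    circleAverageIntegral K (2 * ε) w - circleAverageIntegral K ε w =
      ∫ c in K, logBump ε (c - w) := by
  have h {r : ℝ} (hr : 0 < r) : IntegrableOn (fun c : ℂ => Real.log (max r ‖c - w‖)) K := by
    refine ContinuousOn.integrableOn_compact hK (Continuous.continuousOn ?_)
    exact .log (by fun_prop) fun x => by positivity
  simp only [circleAverageIntegral, logBump]
  rw [integral_sub (h (by positivity)) (h hε)]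
  simp only [circleAverage_log_norm_sub_eq_log_max _ _ hε,
    circleAverage_log_norm_sub_eq_log_max _ _ (show 0 < 2 * ε by positivity)]

/-- Convergence of logarithmic potentials almost everywhere on an open set of full limit measure
implies weak convergence: the test functions `∫ c in K, logBump ε (c - ·)` have integrals that are
expressed through potentials, and they separate compact sets from complements of neighbourhoods. -/
theorem tendsto_of_tendsto_logPotential {ν : ℕ → ProbabilityMeasure ℂ} {ν' : ProbabilityMeasure ℂ}
    {R : ℝ} (hν : ∀ n, ∀ᵐ w ∂(ν n : Measure ℂ), ‖w‖ ≤ R) (hν' : ∀ᵐ w ∂(ν' : Measure ℂ), ‖w‖ ≤ R)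
    {A : Set ℂ} (hA : IsOpen A) (hA' : (ν' : Measure ℂ) Aᶜ = 0)
    (hlim : ∀ᵐ z ∂(volume : Measure ℂ), z ∈ A →
      Tendsto (fun n => logPotential (ν n) z) atTop (𝓝 (logPotential ν' z))) :
    Tendsto ν atTop (𝓝 ν') := by
  refine tendsto_of_forall_isOpen_le_liminf' fun G hG => le_of_forall_lt fun a ha => ?_
  rw [← measure_inter_add_sdiff G hA.measurableSet,
    measure_mono_null (fun x hx => hx.2 : G \ A ⊆ Aᶜ) hA', add_zero] at ha
  obtain ⟨b, hab, hb⟩ := exists_between ha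
  refine hab.trans_le ?_
  obtain ⟨K, hKGA, hK, hbK⟩ := (hG.inter hA).exists_lt_isCompact hb
  obtain ⟨δ, hδ, hδK⟩ := hK.exists_cthickening_subset_open (hG.inter hA) hKGA
  obtain ⟨ε, hε, rfl⟩ : ∃ ε, 0 < ε ∧ δ = 2 * ε + 2 * ε := ⟨δ / 4, by positivity, by ring⟩
  -- The centres fill the `2 * ε`-neighbourhood of `K`: bumps centred off `K'` vanish on `K`.
  -- Another `2 * ε` is left for the support of the bumps.
  set K' := Metric.cthickening (2 * ε) K
  have hK' : IsCompact K' := hK.cthickening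
  have hK'2 : Metric.cthickening (2 * ε) K' ⊆ G ∩ A :=
    (Metric.cthickening_cthickening_subset (by positivity) (by positivity) K).trans hδK
  have hK'1 : Metric.cthickening ε K' ⊆ G ∩ A :=
    (Metric.cthickening_mono (by linarith) _).trans hK'2
  set h : ℂ → ℝ := fun w => ∫ c in K', logBump ε (c - w) with hh
  set β : ℝ := ∫ x, logBump ε x with hβ
  have hβ0 : 0 < β := integral_logBump_pos hε
  have h_nonneg (w : ℂ) : 0 ≤ h w := integral_nonneg fun c => logBump_nonneg hε _
  have h_eq (w : ℂ) (hw : w ∈ K) : h w = β := by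
    rw [hβ, ← integral_sub_right_eq_self _ w]
    refine setIntegral_eq_integral_of_forall_compl_eq_zero fun c hc => logBump_eq_zero hε ?_
    by_contra! hlt
    exact hc (Metric.mem_cthickening_of_dist_le _ _ _ _ hw (by rw [dist_eq_norm]; exact hlt.le))
  have h_le (w : ℂ) : h w ≤ β := by
    rw [hβ, ← integral_sub_right_eq_self _ w]
    exact setIntegral_le_integral (integrable_logBump_sub hε w)
      (ae_of_all _ fun c => logBump_nonneg hε _)
  have h_zero (w : ℂ) (hw : w ∉ G) : h w = 0 := by
    refine setIntegral_eq_zero_of_forall_eq_zero fun c hc => logBump_eq_zero hε ?_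
    by_contra! hlt
    refine hw (hK'2 (Metric.mem_cthickening_of_dist_le _ _ _ _ hc ?_)).1
    rw [dist_eq_norm, norm_sub_rev]
    exact hlt.le
  have h_int {κ : Measure ℂ} [IsProbabilityMeasure κ] (hκ : ∀ᵐ w ∂κ, ‖w‖ ≤ R) :
      Integrable h κ ∧ ∫ w, h w ∂κ = (∫ w, circleAverageIntegral K' (2 * ε) w ∂κ) -
        ∫ w, circleAverageIntegral K' ε w ∂κ := by
    have h1 := integrable_circleAverageIntegral hK' (by positivity : 0 ≤ 2 * ε) κ hκ
    have h2 := integrable_circleAverageIntegral hK' hε.le κ hκ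
    simp only [hh, ← circleAverageIntegral_sub_eq hK' hε]
    exact ⟨h1.sub h2, integral_sub h1 h2⟩
  have h_tendsto : Tendsto (fun n => ∫ w, h w ∂(ν n : Measure ℂ)) atTop
      (𝓝 (∫ w, h w ∂(ν' : Measure ℂ))) := by
    have hres {B : Set ℂ} (hB : MeasurableSet B) (hBA : B ⊆ G ∩ A) :
        ∀ᵐ z ∂volume.restrict B,
          Tendsto (fun n => logPotential (ν n) z) atTop (𝓝 (logPotential ν' z)) := by
      rw [ae_restrict_iff' hB]
      filter_upwards [hlim] with z hz hzB using hz (hBA hzB).2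
    simp only [(h_int hν').2, fun n => (h_int (hν n)).2]
    exact (tendsto_integral_circleAverageIntegral hK' (by positivity) hν hν'
        (hres Metric.isClosed_cthickening.measurableSet hK'2)).sub
      (tendsto_integral_circleAverageIntegral hK' hε.le hν hν'
        (hres Metric.isClosed_cthickening.measurableSet hK'1))
  have h_lower : β * (ν' : Measure ℂ).real K ≤ ∫ w, h w ∂(ν' : Measure ℂ) := by
    calc β * (ν' : Measure ℂ).real K = ∫ w in K, h w ∂(ν' : Measure ℂ) := by
          rw [setIntegral_congr_fun hK.measurableSet (fun w hw => h_eq w hw)]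
          simp [mul_comm]
      _ ≤ _ := setIntegral_le_integral (h_int hν').1 (ae_of_all _ h_nonneg)
  have h_upper (n : ℕ) : ∫ w, h w ∂(ν n : Measure ℂ) ≤ β * (ν n : Measure ℂ).real G := by
    calc ∫ w, h w ∂(ν n : Measure ℂ) = ∫ w in G, h w ∂(ν n : Measure ℂ) :=
          (setIntegral_eq_integral_of_forall_compl_eq_zero h_zero).symm
      _ ≤ ∫ w in G, β ∂(ν n : Measure ℂ) :=
          integral_mono (h_int (hν n)).1.integrableOn (integrable_const _) h_le
      _ = _ := by simp [mul_comm]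
  have hb_top : b ≠ ∞ := (hbK.trans (measure_lt_top _ _)).ne
  have hbK' : b.toReal < (ν' : Measure ℂ).real K :=
    (ENNReal.toReal_lt_toReal hb_top (measure_ne_top _ _)).2 hbK
  refine le_liminf_of_le (by isBoundedDefault) ?_
  filter_upwards [h_tendsto.eventually_const_lt
    ((mul_lt_mul_of_pos_left hbK' hβ0).trans_le h_lower)] with n hn
  rw [← ENNReal.toReal_le_toReal hb_top (measure_ne_top _ _)]
  exact (lt_of_mul_lt_mul_left (hn.trans_le (h_upper n)) hβ0.le).le

/-! ### The solutions of `p_n(w) = p_n(0)` -/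

lemma integrable_sum_dirac_and_integral {α : Type*} [MeasurableSpace α] [MeasurableSingletonClass α]
    (s : Multiset α) (f : α → ℝ) :
    Integrable f (s.map Measure.dirac).sum ∧
      ∫ x, f x ∂(s.map Measure.dirac).sum = (s.map f).sum := by
  induction s using Multiset.induction_on with
  | empty => simp
  | cons a s ih =>
    have h : Integrable f (Measure.dirac a) := integrable_dirac (by simp)
    simp only [Multiset.map_cons, Multiset.sum_cons]
    exact ⟨h.add_measure ih.1, by rw [integral_add_measure h ih.1, ih.2, integral_dirac]⟩

lemma sum_dirac_apply_univ {α : Type*} [MeasurableSpace α] (s : Multiset α) :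
    (s.map Measure.dirac).sum Set.univ = s.card := by
  induction s using Multiset.induction_on with
  | empty => simp
  | cons a s ih => simp [ih, add_comm]

lemma ae_sum_dirac {α : Type*} [MeasurableSpace α] [MeasurableSingletonClass α]
    {s : Multiset α} {p : α → Prop} (h : ∀ x ∈ s, p x) : ∀ᵐ x ∂(s.map Measure.dirac).sum, p x := by
  induction s using Multiset.induction_on with
  | empty => simp
  | cons a s ih =>
    simp only [Multiset.map_cons, Multiset.sum_cons, ae_add_measure_iff]
    refine ⟨?_, ih fun x hx => h x (Multiset.mem_cons_of_mem hx)⟩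
    rw [ae_dirac_eq]
    exact h a (Multiset.mem_cons_self a s)

lemma toMeasure_levelMeasure (z : ℕ → ℂ) (n : ℕ) :
    (levelMeasure z n : Measure ℂ) =
      (n : ℝ≥0)⁻¹ • ((levelSolutions z n).map Measure.dirac).sum := by
  have h (s : Multiset ℂ) : (((s.map fun w => (diracProba w).toFiniteMeasure).sum :
      FiniteMeasure ℂ) : Measure ℂ) = (s.map Measure.dirac).sum := by
    induction s using Multiset.induction_on with
    | empty => simp
    | cons a s ih =>
      rw [Multiset.map_cons, Multiset.sum_cons, FiniteMeasure.toMeasure_add, ih, Multiset.map_cons,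
        Multiset.sum_cons]
      rfl
  rw [levelMeasure, FiniteMeasure.toMeasure_smul, h]

lemma monic_rootProduct (z : ℕ → ℂ) (n : ℕ) : (rootProduct z n).Monic :=
  Polynomial.monic_prod_of_monic _ _ fun _ _ => Polynomial.monic_X_sub_C _

lemma natDegree_rootProduct (z : ℕ → ℂ) (n : ℕ) : (rootProduct z n).natDegree = n := by
  rw [rootProduct, Polynomial.natDegree_prod_of_monic _ _ fun _ _ => Polynomial.monic_X_sub_C _]
  simp

lemma eval_rootProduct (z : ℕ → ℂ) (n : ℕ) (x : ℂ) :
    (rootProduct z n).eval x = ∏ k ∈ Finset.range n, (x - z k) := by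
  simp [rootProduct, Polynomial.eval_prod]

lemma degree_C_lt_degree_rootProduct (z : ℕ → ℂ) {n : ℕ} (hn : n ≠ 0) (a : ℂ) :
    (Polynomial.C a).degree < (rootProduct z n).degree := by
  rw [Polynomial.degree_eq_natDegree (monic_rootProduct z n).ne_zero, natDegree_rootProduct]
  exact Polynomial.degree_C_le.trans_lt (by exact_mod_cast Nat.pos_of_ne_zero hn)

lemma card_levelSolutions (z : ℕ → ℂ) {n : ℕ} (hn : n ≠ 0) : (levelSolutions z n).card = n := by
  rw [levelSolutions, IsAlgClosed.card_roots_eq_natDegree,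
    Polynomial.natDegree_sub_eq_left_of_natDegree_lt, natDegree_rootProduct]
  rw [natDegree_rootProduct, Polynomial.natDegree_C]
  exact Nat.pos_of_ne_zero hn

lemma eval_rootProduct_sub_eval_zero (z : ℕ → ℂ) {n : ℕ} (hn : n ≠ 0) (x : ℂ) :
    (rootProduct z n).eval x - (rootProduct z n).eval 0 =
      ((levelSolutions z n).map fun w => x - w).prod := by
  have h := (IsAlgClosed.splits (rootProduct z n -
    Polynomial.C ((rootProduct z n).eval 0))).eval_eq_prod_roots x
  rw [((monic_rootProduct z n).sub_of_left (degree_C_lt_degree_rootProduct z hn _)).leadingCoeff,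
    one_mul] at h
  simpa [levelSolutions] using h

/-- If `‖w‖ > 2 * R`, every factor `‖w - z k‖` exceeds `R`, whereas every `‖0 - z k‖` is at most
`R`. -/
lemma norm_le_of_mem_levelSolutions {z : ℕ → ℂ} {n : ℕ} (hn : n ≠ 0) {R : ℝ}
    (hz : ∀ k, ‖z k‖ ≤ R) {w : ℂ} (hw : w ∈ levelSolutions z n) : ‖w‖ ≤ 2 * R := by
  by_contra! hlt
  have h0 : (rootProduct z n).eval w = (rootProduct z n).eval 0 := by
    have := (Polynomial.mem_roots'.1 hw).2
    simpa [Polynomial.IsRoot, sub_eq_zero] using this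
  have h1 : ‖(rootProduct z n).eval 0‖ < ‖(rootProduct z n).eval w‖ := by
    rw [eval_rootProduct, eval_rootProduct, norm_prod, norm_prod]
    have hR : 0 ≤ R := (norm_nonneg _).trans (hz 0)
    calc ∏ k ∈ Finset.range n, ‖0 - z k‖ ≤ ∏ _k ∈ Finset.range n, R :=
          Finset.prod_le_prod (fun _ _ => norm_nonneg _) fun k _ => by simpa using hz k
      _ < ∏ _k ∈ Finset.range n, (‖w‖ - R) := by
          simp only [Finset.prod_const, Finset.card_range]
          exact pow_lt_pow_left₀ (by linarith) hR hn
      _ ≤ ∏ k ∈ Finset.range n, ‖w - z k‖ :=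
          Finset.prod_le_prod (fun _ _ => by linarith) fun k _ => by
            linarith [norm_sub_norm_le w (z k), hz k]
  exact h1.ne' (by rw [h0])

lemma isProbabilityMeasure_levelMeasure (z : ℕ → ℂ) {n : ℕ} (hn : n ≠ 0) :
    IsProbabilityMeasure (levelMeasure z n : Measure ℂ) := by
  constructor
  rw [toMeasure_levelMeasure, Measure.smul_apply, sum_dirac_apply_univ, card_levelSolutions z hn,
    ENNReal.smul_def, smul_eq_mul, ENNReal.coe_inv (by simpa using hn), ENNReal.coe_natCast]
  exact ENNReal.inv_mul_cancel (by simpa using hn) (by simp)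

lemma ae_norm_le_levelMeasure {z : ℕ → ℂ} {n : ℕ} (hn : n ≠ 0) {R : ℝ}
    (hz : ∀ k, ‖z k‖ ≤ R) : ∀ᵐ w ∂(levelMeasure z n : Measure ℂ), ‖w‖ ≤ 2 * R := by
  rw [toMeasure_levelMeasure]
  exact Measure.ae_smul_measure (ae_sum_dirac fun w hw => norm_le_of_mem_levelSolutions hn hz hw) _

lemma logPotential_levelMeasure (z : ℕ → ℂ) {n : ℕ} (hn : n ≠ 0) {x : ℂ}
    (hx : (rootProduct z n).eval x ≠ (rootProduct z n).eval 0) :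
    logPotential (levelMeasure z n : Measure ℂ) x =
      Real.log ‖(rootProduct z n).eval x - (rootProduct z n).eval 0‖ / n := by
  have h0 : ∀ w ∈ levelSolutions z n, ‖x - w‖ ≠ 0 := by
    intro w hw h
    obtain rfl : x = w := sub_eq_zero.1 (norm_eq_zero.1 h)
    have := (Polynomial.mem_roots'.1 hw).2
    exact hx (by simpa [Polynomial.IsRoot, sub_eq_zero] using this)
  have h1 (s : Multiset ℂ) (hs : ∀ w ∈ s, ‖x - w‖ ≠ 0) :
      Real.log ‖(s.map fun w => x - w).prod‖ = (s.map fun w => Real.log ‖x - w‖).sum := by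
    induction s using Multiset.induction_on with
    | empty => simp
    | cons a s ih =>
      have h2 : ‖(s.map fun w => x - w).prod‖ ≠ 0 := by
        refine norm_ne_zero_iff.2 (Multiset.prod_ne_zero ?_)
        simp only [Multiset.mem_map, not_exists, not_and]
        exact fun w hw h => hs w (Multiset.mem_cons_of_mem hw) (norm_eq_zero.2 h)
      rw [Multiset.map_cons, Multiset.prod_cons, norm_mul, Multiset.map_cons, Multiset.sum_cons,
        Real.log_mul (hs a (Multiset.mem_cons_self a s)) h2,
        ih fun w hw => hs w (Multiset.mem_cons_of_mem hw)]
  rw [eval_rootProduct_sub_eval_zero z hn, h1 _ h0, logPotential, toMeasure_levelMeasure,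
    integral_smul_nnreal_measure, (integrable_sum_dirac_and_integral _ _).2, NNReal.smul_def,
    smul_eq_mul, NNReal.coe_inv, NNReal.coe_natCast]
  ring

lemma log_norm_eval_rootProduct {z : ℕ → ℂ} {x : ℂ} (hx : ∀ k, x ≠ z k) (n : ℕ) :
    Real.log ‖(rootProduct z n).eval x‖ = ∑ k ∈ Finset.range n, Real.log ‖x - z k‖ := by
  rw [eval_rootProduct, norm_prod, Real.log_prod]
  exact fun k _ => norm_ne_zero_iff.2 (sub_ne_zero.2 (hx k))

/-- If the exponential growth rate `a` of `p_n x` exceeds that of `p_n 0`, then subtracting `p_n 0`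
does not change the growth rate, and the potential of the level measure at `x` tends to `a`. -/
lemma tendsto_logPotential_levelMeasure {z : ℕ → ℂ} {x : ℂ} {a b : ℝ} (hab : b < a)
    (hx : ∀ k, x ≠ z k) (h0 : ∀ k, 0 ≠ z k)
    (ha : Tendsto (fun n : ℕ => (∑ k ∈ Finset.range n, Real.log ‖x - z k‖) / n) atTop (𝓝 a))
    (hb : Tendsto (fun n : ℕ => (∑ k ∈ Finset.range n, Real.log ‖0 - z k‖) / n) atTop (𝓝 b)) :
    Tendsto (fun n : ℕ => logPotential (levelMeasure z n : Measure ℂ) x) atTop (𝓝 a) := by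
  set p := fun n => (rootProduct z n).eval x with hp
  set q := fun n => (rootProduct z n).eval 0 with hq
  simp only [← log_norm_eval_rootProduct hx] at ha
  simp only [← log_norm_eval_rootProduct h0] at hb
  have hp0 (n : ℕ) : p n ≠ 0 := by
    simp only [hp, eval_rootProduct]
    exact Finset.prod_ne_zero_iff.2 fun k _ => sub_ne_zero.2 (hx k)
  have hq0 (n : ℕ) : q n ≠ 0 := by
    simp only [hq, eval_rootProduct]
    exact Finset.prod_ne_zero_iff.2 fun k _ => sub_ne_zero.2 (h0 k)
  have hratio : Tendsto (fun n => q n / p n) atTop (𝓝 0) := by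
    have h1 : Tendsto (fun n : ℕ => (n : ℝ) * (Real.log ‖q n‖ / n - Real.log ‖p n‖ / n))
        atTop atBot :=
      tendsto_natCast_atTop_atTop.atTop_mul_neg (by linarith : b - a < 0) (hb.sub ha)
    rw [tendsto_zero_iff_norm_tendsto_zero]
    refine (Real.tendsto_exp_atBot.comp h1).congr' ?_
    filter_upwards [eventually_ne_atTop 0] with n hn
    have : (n : ℝ) ≠ 0 := by exact_mod_cast hn
    simp only [Function.comp_apply]
    rw [← sub_div, mul_div_cancel₀ _ this, Real.exp_sub, Real.exp_log (norm_pos_iff.2 (hq0 n)),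
      Real.exp_log (norm_pos_iff.2 (hp0 n)), norm_div]
  have hone : Tendsto (fun n => 1 - q n / p n) atTop (𝓝 1) := by
    simpa using tendsto_const_nhds.sub hratio
  have hlog : Tendsto (fun n : ℕ => Real.log ‖1 - q n / p n‖ / n) atTop (𝓝 0) := by
    have h1 : Tendsto (fun n => Real.log ‖1 - q n / p n‖) atTop (𝓝 0) := by
      simpa using hone.norm.log (by simp)
    exact h1.div_atTop tendsto_natCast_atTop_atTop
  have hsum := ha.add hlog
  rw [add_zero] at hsum
  refine hsum.congr' ?_
  filter_upwards [hone.eventually_ne one_ne_zero, eventually_ne_atTop 0] with n h1 hn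
  have hmul : p n - q n = p n * (1 - q n / p n) := by field_simp [hp0 n]
  have hne : p n ≠ q n := by
    rw [← sub_ne_zero, hmul]
    exact mul_ne_zero (hp0 n) h1
  rw [logPotential_levelMeasure z hn hne, ← add_div]
  change _ = Real.log ‖p n - q n‖ / n
  rw [hmul, norm_mul, Real.log_mul (norm_ne_zero_iff.2 (hp0 n)) (norm_ne_zero_iff.2 h1)]

/-! ### Potentials of radial measures -/

lemma le_smul_restrict_closedBall {μ : Measure ℂ} {ρ : ℂ → ℝ≥0} {M : ℝ≥0} {R : ℝ}
    (hdens : μ = (volume : Measure ℂ).withDensity (fun x => (ρ x : ℝ≥0∞)))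
    (hR : ∀ᵐ w ∂μ, ‖w‖ ≤ R) (hM : ∀ x ∈ Metric.closedBall 0 R, ρ x ≤ M) :
    μ ≤ M • volume.restrict (Metric.closedBall 0 R) := by
  refine Measure.le_iff.2 fun s hs => ?_
  have h0 : μ (s \ Metric.closedBall 0 R) = 0 := by
    refine measure_mono_null (fun x hx => ?_) hR
    simpa using hx.2
  rw [← measure_inter_add_sdiff s (measurableSet_closedBall (x := (0 : ℂ)) (ε := R)), h0, add_zero,
    hdens, withDensity_apply _ (hs.inter measurableSet_closedBall), Measure.smul_apply,
    Measure.restrict_apply hs]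
  calc ∫⁻ x in s ∩ Metric.closedBall 0 R, (ρ x : ℝ≥0∞)
      ≤ ∫⁻ _ in s ∩ Metric.closedBall 0 R, (M : ℝ≥0∞) :=
        setLIntegral_mono measurable_const fun x hx => by exact_mod_cast hM x hx.2
    _ = _ := by simp [ENNReal.smul_def]

lemma logPotential_eq_of_norm_eq {μ : Measure ℂ} {ρ : ℂ → ℝ≥0}
    (hdens : μ = (volume : Measure ℂ).withDensity (fun x => (ρ x : ℝ≥0∞)))
    (hρ : Measurable ρ) (hrad : ∀ x y : ℂ, ‖x‖ = ‖y‖ → ρ x = ρ y) {x y : ℂ} (hxy : ‖x‖ = ‖y‖) :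
    logPotential μ x = logPotential μ y := by
  have key (a : Circle) (x : ℂ) : logPotential μ (a * x) = logPotential μ x := by
    simp only [logPotential, hdens]
    rw [integral_withDensity_eq_integral_smul hρ, integral_withDensity_eq_integral_smul hρ,
      ← (rotation a).measurePreserving.integral_comp'
        (f := (rotation a).toHomeomorph.toMeasurableEquiv)]
    refine integral_congr_ae (ae_of_all _ fun w => ?_)
    have h1 : ρ (rotation a w) = ρ w := hrad _ _ (LinearIsometryEquiv.norm_map _ _)
    have h2 : ‖(a : ℂ) * x - rotation a w‖ = ‖x - w‖ := by
      rw [rotation_apply, ← mul_sub, norm_mul, Circle.norm_coe, one_mul]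
    change ρ (rotation a w) • Real.log ‖(a : ℂ) * x - rotation a w‖ = _
    rw [h1, h2]
  rcases eq_or_ne x 0 with rfl | hx
  · rw [norm_zero, eq_comm, norm_eq_zero] at hxy
    rw [hxy]
  · have h : ‖y / x‖ = 1 := by rw [norm_div, hxy, div_self (hxy ▸ norm_ne_zero_iff.2 hx)]
    have := key ⟨y / x, mem_sphere_zero_iff_norm.2 h⟩ x
    rw [← this]
    simp [div_mul_cancel₀ y hx]

/-- **Newton's theorem** in the plane: the potential at `x` of a radial measure is that of a measure
in which the mass inside the disc of radius `‖x‖` sits at the origin. -/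
lemma logPotential_eq_integral_log_max {μ : Measure ℂ} [IsFiniteMeasure μ] {ρ : ℂ → ℝ≥0}
    {M : ℝ≥0} {R : ℝ} (hdens : μ = (volume : Measure ℂ).withDensity (fun x => (ρ x : ℝ≥0∞)))
    (hρ : Measurable ρ) (hrad : ∀ x y : ℂ, ‖x‖ = ‖y‖ → ρ x = ρ y)
    (hμM : μ ≤ M • volume.restrict (Metric.closedBall 0 R)) {x : ℂ} (hx : x ≠ 0) :
    Integrable (fun w => Real.log (max ‖x‖ ‖w‖)) μ ∧
      logPotential μ x = ∫ w, Real.log (max ‖x‖ ‖w‖) ∂μ := by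
  have hx' : 0 < ‖x‖ := norm_pos_iff.2 hx
  set σ : Measure ℝ := volume.restrict (Set.Ioc 0 (2 * Real.pi)) with hσ
  have hint : Integrable (fun p : ℂ × ℝ => Real.log ‖p.1 - circleMap 0 ‖x‖ p.2‖) (μ.prod σ) :=
    integrable_log_norm_sub_prod (R := ‖x‖) hμM σ (continuous_circleMap 0 _).measurable
      (ae_of_all _ fun θ => by simp)
  have hmax (w : ℂ) : Real.log (max ‖x‖ ‖w‖) =
      (2 * Real.pi)⁻¹ * ∫ θ, Real.log ‖w - circleMap 0 ‖x‖ θ‖ ∂σ := by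
    have := circleAverage_log_norm_sub_eq_log_max 0 w hx'
    rw [zero_sub, norm_neg] at this
    rw [← this, Real.circleAverage, intervalIntegral.integral_of_le (by positivity), smul_eq_mul]
    simp only [norm_sub_rev, hσ]
  refine ⟨?_, ?_⟩
  · simp only [hmax]
    exact hint.integral_prod_left.const_mul _
  · simp only [hmax]
    rw [integral_const_mul, integral_integral_swap hint]
    have hconst (θ : ℝ) : ∫ w, Real.log ‖w - circleMap 0 ‖x‖ θ‖ ∂μ = logPotential μ x := by
      rw [logPotential_eq_of_norm_eq hdens hρ hrad (show ‖x‖ = ‖circleMap 0 ‖x‖ θ‖ by simp)]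
      simp only [logPotential, norm_sub_rev]
    simp only [hconst, integral_const]
    have h2 : σ.real Set.univ = 2 * Real.pi := by simp [hσ, Real.pi_pos.le]
    rw [h2, smul_eq_mul, inv_mul_cancel_left₀ (by positivity)]

lemma integrable_log_norm_sub {μ : Measure ℂ} [IsFiniteMeasure μ] {M : ℝ≥0} {R : ℝ}
    (hμM : μ ≤ M • volume.restrict (Metric.closedBall 0 R)) (x : ℂ) :
    Integrable (fun w => Real.log ‖x - w‖) μ := by
  have h := integrable_log_norm_sub_prod (R := ‖x‖) hμM (Measure.dirac (0 : ℂ))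
    (measurable_const (a := x)) (ae_of_all _ fun _ => le_rfl)
  simpa only [integral_dirac, norm_sub_rev] using h.integral_prod_left

/-- Equality of the potentials at `0` and `x` would need every point of mass to lie outside the
disc of radius `‖x‖`, where `log (max ‖x‖ ‖w‖) = log ‖w‖`. -/
lemma logPotential_zero_lt {μ : Measure ℂ} [IsFiniteMeasure μ] {ρ : ℂ → ℝ≥0}
    {M : ℝ≥0} {R : ℝ} (hdens : μ = (volume : Measure ℂ).withDensity (fun x => (ρ x : ℝ≥0∞)))
    (hρ : Measurable ρ) (hrad : ∀ x y : ℂ, ‖x‖ = ‖y‖ → ρ x = ρ y)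
    (hμM : μ ≤ M • volume.restrict (Metric.closedBall 0 R)) {x : ℂ}
    (hx : μ (Metric.ball 0 ‖x‖) ≠ 0) : logPotential μ 0 < logPotential μ x := by
  have hx0 : x ≠ 0 := by
    rintro rfl
    simp at hx
  have hac : μ ≪ volume := hdens ▸ withDensity_absolutelyContinuous _ _
  have h0 : ∀ᵐ w ∂μ, w ≠ 0 := hac.ae_le (compl_mem_ae_iff.2 (measure_singleton 0))
  obtain ⟨hi, he⟩ := logPotential_eq_integral_log_max hdens hρ hrad hμM hx0
  rw [he, logPotential]
  have hle : ∀ᵐ w ∂μ, Real.log ‖0 - w‖ ≤ Real.log (max ‖x‖ ‖w‖) := by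
    filter_upwards [h0] with w hw
    rw [zero_sub, norm_neg]
    exact Real.log_le_log (norm_pos_iff.2 hw) (le_max_right _ _)
  refine lt_of_le_of_ne (integral_mono_ae (integrable_log_norm_sub hμM 0) hi hle) fun h => hx ?_
  rw [integral_eq_iff_of_ae_le (integrable_log_norm_sub hμM 0) hi hle] at h
  have hout : ∀ᵐ w ∂μ, w ∉ Metric.ball 0 ‖x‖ := by
    filter_upwards [h, h0] with w hw hw0 hwx
    rw [Metric.mem_ball, dist_zero_right] at hwx
    simp only [zero_sub, norm_neg, max_eq_left hwx.le] at hw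
    exact (Real.log_lt_log (norm_pos_iff.2 hw0) hwx).ne hw
  exact compl_mem_ae_iff.1 hout

/-- The points farther from the origin than some point of the support form an open set of full
measure. -/
lemma exists_measure_compl_setOf_lt_norm_eq_zero {μ : Measure ℂ} [IsProbabilityMeasure μ]
    (hac : μ ≪ volume) (hsupp : IsCompact μ.support) :
    ∃ m : ℝ, μ {x | m < ‖x‖}ᶜ = 0 ∧ ∀ x : ℂ, m < ‖x‖ → μ (Metric.ball 0 ‖x‖) ≠ 0 := by
  have hnull : μ μ.supportᶜ = 0 := Measure.measure_compl_support_of_regular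
  have hne : μ.support.Nonempty := by
    rw [Set.nonempty_iff_ne_empty]
    intro h
    simp [h] at hnull
  obtain ⟨s, hs, hmin⟩ := hsupp.exists_isMinOn hne continuous_norm.continuousOn
  refine ⟨‖s‖, ?_, fun x hx => ?_⟩
  · have hsphere : μ (Metric.sphere 0 ‖s‖) = 0 := hac (Measure.addHaar_sphere _ _ _)
    refine measure_mono_null (fun w hw => ?_) (measure_union_null hnull hsphere)
    by_cases hw' : w ∈ μ.support
    · right
      simp only [Set.mem_compl_iff, Set.mem_ofPred_eq, not_lt] at hw
      simpa using le_antisymm hw (hmin hw')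
    · exact Or.inl hw'
  · exact ((Measure.mem_support_iff_forall s).1 hs _
      (Metric.isOpen_ball.mem_nhds (by simpa using hx))).ne'

/-! ### The law of large numbers and the limit of the level measures -/

/-- The strong law of large numbers for `log ‖x - Z k‖`, at almost every point `x` at once. -/
lemma ae_ae_tendsto_sum_log_norm_sub {μ : Measure ℂ} [IsProbabilityMeasure μ] {M : ℝ≥0} {R : ℝ}
    (hμM : μ ≤ M • volume.restrict (Metric.closedBall 0 R))
    {Ω : Type*} [MeasurableSpace Ω] {P : Measure Ω} [IsProbabilityMeasure P] {Z : ℕ → Ω → ℂ}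
    (hlaw : ∀ k, HasLaw (Z k) μ P) (hindep : iIndepFun Z P) (l : Measure ℂ) [SFinite l] :
    ∀ᵐ ω ∂P, ∀ᵐ x ∂l, Tendsto (fun n : ℕ => (∑ k ∈ Finset.range n, Real.log ‖x - Z k ω‖) / n)
      atTop (𝓝 (logPotential μ x)) := by
  -- Exchanging the two quantifiers requires measurable versions of the `Z k`.
  set Y : ℕ → Ω → ℂ := fun k => (hlaw k).aemeasurable.mk (Z k)
  have hY (k : ℕ) : Measurable (Y k) := (hlaw k).aemeasurable.measurable_mk
  have hZY (k : ℕ) : Z k =ᵐ[P] Y k := (hlaw k).aemeasurable.ae_eq_mk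
  have hlawY (k : ℕ) : HasLaw (Y k) μ P := (hlaw k).congr (hZY k).symm
  have hindepY : iIndepFun Y P := hindep.congr hZY
  have hslln (x : ℂ) : ∀ᵐ ω ∂P,
      Tendsto (fun n : ℕ => (∑ k ∈ Finset.range n, Real.log ‖x - Y k ω‖) / n)
        atTop (𝓝 (logPotential μ x)) := by
    have hm : Measurable (fun w : ℂ => Real.log ‖x - w‖) := by fun_prop
    have hi : Integrable (fun w : ℂ => Real.log ‖x - w‖) (P.map (Y 0)) := by
      rw [(hlawY 0).map_eq]
      exact integrable_log_norm_sub hμM x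
    have h := strong_law_ae_real (fun k ω => Real.log ‖x - Y k ω‖)
      (hi.comp_measurable (hY 0))
      (fun i j hij => (hindepY.indepFun hij).comp hm hm)
      (fun k => IdentDistrib.comp ⟨(hY k).aemeasurable, (hY 0).aemeasurable,
        (hlawY k).map_eq.trans (hlawY 0).map_eq.symm⟩ hm)
    have he : ∫ ω, Real.log ‖x - Y 0 ω‖ ∂P = logPotential μ x := by
      rw [logPotential, ← (hlawY 0).map_eq,
        integral_map (hY 0).aemeasurable hm.aestronglyMeasurable]
    rwa [he] at h
  have hmeas : MeasurableSet {p : ℂ × Ω |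
      Tendsto (fun n : ℕ => (∑ k ∈ Finset.range n, Real.log ‖p.1 - Y k p.2‖) / n)
        atTop (𝓝 (logPotential μ p.1))} := by
    have hU := measurable_logPotential μ
    have h := measurableSet_tendsto (l := atTop) (𝓝 (0 : ℝ)) (f := fun (n : ℕ) (p : ℂ × Ω) =>
      (∑ k ∈ Finset.range n, Real.log ‖p.1 - Y k p.2‖) / n - logPotential μ p.1)
      fun n => by fun_prop
    simpa only [tendsto_sub_nhds_zero_iff] using h
  have h := (Measure.ae_ae_comm hmeas).1 (ae_of_all l hslln)
  filter_upwards [h, ae_all_iff.2 hZY] with ω hω hZω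
  simpa only [hZω] using hω

theorem theorem1 (μ : ProbabilityMeasure ℂ) (ρ : ℂ → ℝ≥0)
    (hsupp : IsCompact (μ : Measure ℂ).support)
    (hdens : (μ : Measure ℂ) = (volume : Measure ℂ).withDensity (fun x => (ρ x : ℝ≥0∞)))
    (hcont : Continuous ρ)
    (hrad : ∀ x y : ℂ, ‖x‖ = ‖y‖ → ρ x = ρ y)
    {Ω : Type*} [MeasurableSpace Ω] (P : Measure Ω) [IsProbabilityMeasure P]
    (Z : ℕ → Ω → ℂ)
    (hlaw : ∀ k, HasLaw (Z k) (μ : Measure ℂ) P)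
    (hindep : iIndepFun Z P) :
    ∀ᵐ ω ∂P, Tendsto (fun n : ℕ => levelMeasure (fun k => Z k ω) n) atTop
      (𝓝 μ.toFiniteMeasure) := by
  have hac : (μ : Measure ℂ) ≪ volume := hdens ▸ withDensity_absolutelyContinuous _ _
  obtain ⟨m, hm0, hm⟩ := exists_measure_compl_setOf_lt_norm_eq_zero hac hsupp
  obtain ⟨R, hR⟩ := hsupp.isBounded.subset_closedBall (0 : ℂ)
  have hμR : ∀ᵐ w ∂(μ : Measure ℂ), ‖w‖ ≤ R := by
    filter_upwards [Measure.support_mem_ae_of_regular (μ := (μ : Measure ℂ))] with w hw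
    simpa using hR hw
  obtain ⟨M, hM⟩ : ∃ M : ℝ≥0, ∀ x ∈ Metric.closedBall (0 : ℂ) R, ρ x ≤ M := by
    obtain ⟨M, hM⟩ := (isCompact_closedBall (0 : ℂ) R).bddAbove_image hcont.continuousOn
    exact ⟨M, fun x hx => hM (Set.mem_image_of_mem _ hx)⟩
  have hμM := le_smul_restrict_closedBall hdens hμR hM
  have hμ0 : ∀ᵐ w ∂(μ : Measure ℂ), 0 ≠ w := by
    filter_upwards [hac.ae_le (compl_mem_ae_iff.2 (measure_singleton (0 : ℂ)))] with w hw
    exact fun h => hw h.symm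
  have hZ : ∀ᵐ ω ∂P, ∀ k, ‖Z k ω‖ ≤ R ∧ 0 ≠ Z k ω := by
    refine ae_all_iff.2 fun k => ae_of_ae_map (p := fun w => ‖w‖ ≤ R ∧ 0 ≠ w)
      (hlaw k).aemeasurable ?_
    rw [(hlaw k).map_eq]
    exact hμR.and hμ0
  filter_upwards [hZ, ae_ae_tendsto_sum_log_norm_sub hμM hlaw hindep volume,
    ae_ae_tendsto_sum_log_norm_sub hμM hlaw hindep (Measure.dirac 0)] with ω hω hlim hlim0
  rw [ae_dirac_eq] at hlim0
  have hR0 : 0 ≤ R := (norm_nonneg _).trans (hω 0).1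
  -- For `n = 0` there are no roots and `levelMeasure` vanishes, so the sequence is shifted by one.
  set ν : ℕ → ProbabilityMeasure ℂ := fun n => ⟨levelMeasure (fun k => Z k ω) (n + 1),
    isProbabilityMeasure_levelMeasure _ n.succ_ne_zero⟩
  have hν : Tendsto ν atTop (𝓝 μ) := by
    refine tendsto_of_tendsto_logPotential (R := 2 * R) (A := {x | m < ‖x‖})
      (fun n => ae_norm_le_levelMeasure n.succ_ne_zero fun k => (hω k).1)
      (by filter_upwards [hμR] with w hw using by linarith)
      (isOpen_lt continuous_const continuous_norm) hm0 ?_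
    have hcount : ∀ᵐ x ∂(volume : Measure ℂ), ∀ k, x ≠ Z k ω :=
      ae_all_iff.2 fun k => compl_mem_ae_iff.2 (measure_singleton (Z k ω))
    filter_upwards [hlim, hcount] with x hx hxZ hxm
    exact (tendsto_logPotential_levelMeasure
      (logPotential_zero_lt hdens hcont.measurable hrad hμM (hm x hxm)) hxZ (fun k => (hω k).2)
      hx hlim0).comp (tendsto_add_atTop_nat 1)
  rw [← tendsto_add_atTop_iff_nat 1]
  exact (ProbabilityMeasure.tendsto_nhds_iff_toFiniteMeasure_tendsto_nhds _).1 hν
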